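/- All graphs are finite and simple; graph homomorphisms are maps of vertices sending edges to edges. $\mathrm{FI}$ is the category of the sets $[n]=\{1,\dots,n\}$, $n\ge 0$, and injections. An FI-graph is a functor $G_\bullet$ from $\mathrm{FI}$ to graphs; it is vertex-stable of stable degree $\le d$ if for all $n\ge d$ every vertex of $G_{n+1}$ is of the form $G(f)(w)$ with $w\in V(G_n)$ and $f:[n]\hookrightarrow[n+1]$. An FI-module over a ring $R$ is a functor $V$ from $\mathrm{FI}$ to $R$-modules; it is finitely generated in degree $\le d$ if there is a finite set of elements of $V_0,\dots,V_d$ whose images under the maps induced by injections span every $V_n$; it is finitely generated if this holds for some $d$; it is $d$-small if it is finitely generated and is a subquotient of an FI-module that is finitely generated in degree $\le d$. For graphs $T$ and $G$, a multi-homomorphism is a map $\alpha$ from $V(T)$ to the non-empty subsets of $V(G)$ such that for every edge $\{x,y\}$ of $T$ and all $v\in\alpha(x)$, $w\in\alpha(y)$, $\{v,w\}$ is an edge of $G$. The Hom-complex $\mathscr{H}om(T,G)$ is the polyhedral complex whose cells are the multi-homomorphisms, the cell $\alpha$ being the product over $x\in V(T)$ of the simplices with vertex sets $\alpha(x)$,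 of dimension $\sum_{x}(|\alpha(x)|-1)$, and $\alpha$ being a face of $\tau$ if and only if $\alpha(x)\subseteq\tau(x)$ for all $x$. Its homology is the homology of its cellular chain complex; a graph homomorphism $f:G\to G'$ induces the cellular map $\alpha\mapsto f(\alpha(\cdot))$, which on chains sends cells whose image has smaller dimension to $0$. **Theorem.** Let $T$ be a graph and let $G_\bullet$ be a vertex-stable FI-graph of stable degree $\le d$. Then: 1. for every $i\ge 0$ the FI-module $H_i(\mathscr{H}om(T,G_\bullet);\mathbb{Z})$ over $\mathbb{Z}$ is $\big((i+1)\,d\,|V(T)|\big)$-small; 2. the functor $n\mapsto\mathscr{H}om(T,G_n)$ is representation stable, i.e. for every $i\ge0$ the FI-module $H_i(\mathscr{H}om(T,G_\bullet);\mathbb{Z})$ is finitely generated; 3. for every $i\ge 0$ there is a polynomial $p\in\mathbb{Q}[X]$ of degree at most $(i+1)\,d\,|V(T)|$ such that $\dim_{\mathbb{R}}H_i(\mathscr{H}om(T,G_n);\mathbb{R})=p(n)$ for all sufficiently large $n$. -/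

import Mathlib

open CategoryTheory

/-! ### The category FI and FI-modules -/

/-- Objects of the category `FI`: the object with underlying number `n` is the finite set
`[n]`, which is modelled by `Fin n`. -/
structure FI : Type where
  /-- the number of elements -/
  card : ℕ

/-- Morphisms `[m] ⟶ [n]` in `FI` are the injections `[m] ↪ [n]`. -/
instance FI.instCategory : Category FI where
  Hom m n := Fin m.card ↪ Fin n.card
  id m := Function.Embedding.refl _
  comp f g := f.trans g

universe u v w

/-- An `FI`-module `V` over `R` is finitely generated in degree `≤ d`: there is a finite set of
elements of `V_0, …, V_d` such that every `V_n` is spanned by the images of these elements under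
the maps induced by injections. -/
def FIModule.FGInDegree {R : Type w} [CommRing R] (V : FI ⥤ ModuleCat.{u} R) (d : ℕ) : Prop :=
  ∃ S : Set (Σ m : FI, V.obj m), S.Finite ∧ (∀ s ∈ S, s.1.card ≤ d) ∧
    ∀ n : FI, Submodule.span R
      {y : V.obj n | ∃ s ∈ S, ∃ f : s.1 ⟶ n, (V.map f).hom s.2 = y} = ⊤

/-- An `FI`-module is finitely generated if it is so in some degree. -/
def FIModule.FG {R : Type w} [CommRing R] (V : FI ⥤ ModuleCat.{u} R) : Prop :=
  ∃ d : ℕ, FIModule.FGInDegree V d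

/-- `V` is a subquotient of `W`: a quotient of a submodule of `W`. -/
def FIModule.IsSubquotient {R : Type w} [CommRing R] (V W : FI ⥤ ModuleCat.{u} R) : Prop :=
  ∃ (A : FI ⥤ ModuleCat.{u} R) (ι : A ⟶ W) (π : A ⟶ V),
    (∀ n, Function.Injective (ι.app n).hom) ∧ (∀ n, Function.Surjective (π.app n).hom)

/-- `V` is `d`-small: it is finitely generated, and it is a subquotient of an `FI`-module which is
finitely generated in degree `≤ d`. -/
def FIModule.IsSmall {R : Type w} [CommRing R] (d : ℕ) (V : FI ⥤ ModuleCat.{u} R) : Prop :=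
  FIModule.FG V ∧
    ∃ W : FI ⥤ ModuleCat.{u} R, FIModule.FGInDegree W d ∧ FIModule.IsSubquotient V W

/-! ### Graphs and FI-graphs -/

/-- A finite simple graph. -/
structure FinGraph : Type (u + 1) where
  /-- the vertices -/
  V : Type u
  [fintypeV : Fintype V]
  /-- the adjacency relation -/
  graph : SimpleGraph V

attribute [instance] FinGraph.fintypeV

/-- The category of finite simple graphs and graph homomorphisms (maps of vertices that send edges
to edges). -/
instance FinGraph.instCategory : Category FinGraph.{u} where
  Hom G H := G.graph →g H.graph
  id G := SimpleGraph.Hom.id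
  comp f g := g.comp f

/-- The map of vertex sets underlying a morphism of graphs. -/
def FinGraph.vmap {G H : FinGraph.{u}} (f : G ⟶ H) : G.V → H.V :=
  fun a => (show G.graph →g H.graph from f) a

/-- An `FI`-graph `G` is vertex-stable with stable degree `≤ d`: for all `n ≥ d`, every vertex of
`G_{n+1}` is the image of a vertex of `G_n` under the transition map of some injection
`[n] ↪ [n+1]`. -/
def VertexStable (G : FI ⥤ FinGraph.{u}) (d : ℕ) : Prop :=
  ∀ n : ℕ, d ≤ n → ∀ a : (G.obj ⟨n + 1⟩).V,
    ∃ (b : (G.obj ⟨n⟩).V) (f : (⟨n⟩ : FI) ⟶ ⟨n + 1⟩), FinGraph.vmap (G.map f) b = a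

/-! ### The Hom-complex

The cells of the Hom-complex of `T` and `G` are the multi-homomorphisms `α` from `T` to `G`; the
cell `α` is the product over the vertices `x` of `T` of the simplices with vertex sets `α x`. Its
dimension is `∑ x, (#(α x) - 1)`, and its faces are the `β` with `β x ⊆ α x` for all `x`. -/

section HomComplex

variable {W : Type v} (T : SimpleGraph W)

/-- `α` is a multi-homomorphism from `T` to `G`. -/
def IsMultiHom {V : Type u} (G : SimpleGraph V) (α : W → Set V) : Prop :=
  (∀ x, (α x).Nonempty) ∧
    ∀ x y, T.Adj x y → ∀ a ∈ α x, ∀ b ∈ α y, G.Adj a b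

/-- The map `x ↦ α x` from vertices of `T` to sets of vertices of `G` given by a list `t` of pairs:
`a ∈ α x` if and only if the pair `(x, a)` is listed. -/
def listedSets {V : Type u} {N : ℕ} (t : Fin N → W × V) : W → Set V :=
  fun x => {a | (x, a) ∈ Set.range t}

/-- `t` is an ordering of a cell of the Hom-complex: it lists, without repetition, the pairs
`(x, a)` with `a ∈ α x`, for a multi-homomorphism `α`. The number of pairs is `∑ x, #(α x)`, which is
the dimension of the cell plus the number of vertices of `T`.

An ordering of a cell orients it, and two orderings of a cell give the same orientation
if and only if they differ by an even permutation: the affine span of the product of the simplices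
on the sets `α x` is the fibre of the linear map `⨁ x, ℝ ^ (α x) → ℝ ^ W` of coordinate sums, so that
(for a fixed orientation of `ℝ ^ W`) to orient the cell is to orient `⨁ x, ℝ ^ (α x)`. -/
def IsCellOrdering {V : Type u} (G : SimpleGraph V) {N : ℕ} (t : Fin N → W × V) : Prop :=
  Function.Injective t ∧ IsMultiHom T G (listedSets t)

variable {T}

theorem listedSets_comp_perm {V : Type u} {N : ℕ} (t : Fin N → W × V) (σ : Equiv.Perm (Fin N)) :
    listedSets (t ∘ σ) = listedSets t := by
  funext x
  simp [listedSets, EquivLike.range_comp]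

theorem isCellOrdering_comp_perm {V : Type u} {G : SimpleGraph V} {N : ℕ} (t : Fin N → W × V)
    (σ : Equiv.Perm (Fin N)) : IsCellOrdering T G (t ∘ σ) ↔ IsCellOrdering T G t := by
  simp [IsCellOrdering, listedSets_comp_perm]

theorem IsCellOrdering.of_cons {V : Type u} {G : SimpleGraph V} {N : ℕ} {t : Fin N → W × V}
    {p : W × V} (h : IsCellOrdering T G (Fin.cons (α := fun _ => W × V) p t))
    (ht : ∀ x, (listedSets t x).Nonempty) : IsCellOrdering T G t := by
  have hsub : ∀ x, listedSets t x ⊆ listedSets (Fin.cons (α := fun _ => W × V) p t) x := by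
    rintro x a ⟨j, hj⟩
    exact ⟨j.succ, by simpa using hj⟩
  refine ⟨fun a b hab => ?_, ht, fun x y hxy a ha b hb => ?_⟩
  · have := @h.1 a.succ b.succ (by simpa using hab)
    simpa using this
  · exact h.2.2 x y hxy a (hsub x ha) b (hsub y hb)

theorem IsCellOrdering.map {G H : FinGraph.{u}} (f : G ⟶ H) {N : ℕ} {s : Fin N → W × G.V}
    (hs : IsCellOrdering T G.graph s) :
    IsMultiHom T H.graph (listedSets (Prod.map id (FinGraph.vmap f) ∘ s)) := by
  refine ⟨fun x => ?_, ?_⟩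
  · obtain ⟨a, j, hj⟩ := hs.2.1 x
    exact ⟨FinGraph.vmap f a, j, by simp [hj]⟩
  · rintro x y hxy a ⟨j, hj⟩ b ⟨k, hk⟩
    have hj1 : (s j).1 = x := congrArg Prod.fst hj
    have hj2 : FinGraph.vmap f (s j).2 = a := congrArg Prod.snd hj
    have hk1 : (s k).1 = y := congrArg Prod.fst hk
    have hk2 : FinGraph.vmap f (s k).2 = b := congrArg Prod.snd hk
    rw [← hj2, ← hk2]
    exact (show G.graph →g H.graph from f).map_adj
      (hs.2.2 x y hxy _ ⟨j, by simp [← hj1]⟩ _ ⟨k, by simp [← hk1]⟩)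

variable [Fintype W] (T) (R : Type w) [CommRing R]

/-- The cellular `i`-chains of the Hom-complex with coefficients in `R`, as the functions that
assign to each ordering `t` of an `i`-cell the coefficient `c t` of the cell with the
orientation given by `t`; the coefficient changes sign with the orientation. (A choice of one
ordering for each cell identifies this module with the free module on the `i`-cells.) -/
def HomComplex.chains (G : FinGraph.{u}) (i : ℕ) :
    Submodule R ((Fin (Fintype.card W + i) → W × G.V) → R) where
  carrier := {c | (∀ (σ : Equiv.Perm (Fin (Fintype.card W + i))) t,
      c (t ∘ σ) = ((Equiv.Perm.sign σ : ℤ) : R) * c t) ∧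
    ∀ t, ¬ IsCellOrdering T G.graph t → c t = 0}
  add_mem' := by
    rintro a b ⟨ha, ha'⟩ ⟨hb, hb'⟩
    refine ⟨fun σ t => ?_, fun t ht => ?_⟩
    · simp only [Pi.add_apply, ha σ t, hb σ t]; ring
    · simp [ha' t ht, hb' t ht]
  zero_mem' := by simp
  smul_mem' := by
    rintro r a ⟨ha, ha'⟩
    refine ⟨fun σ t => ?_, fun t ht => ?_⟩
    · simp only [Pi.smul_apply, ha σ t, smul_eq_mul]; ring
    · simp [ha' t ht]

variable {T} {R}

namespace HomComplex

theorem chains_perm {G : FinGraph.{u}} {i : ℕ} (c : chains T R G i)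
    (σ : Equiv.Perm (Fin (Fintype.card W + i))) (t : Fin (Fintype.card W + i) → W × G.V) :
    c.1 (t ∘ σ) = ((Equiv.Perm.sign σ : ℤ) : R) * c.1 t := c.2.1 σ t

theorem chains_eq_zero {G : FinGraph.{u}} {i : ℕ} (c : chains T R G i)
    (t : Fin (Fintype.card W + i) → W × G.V) (ht : ¬ IsCellOrdering T G.graph t) :
    c.1 t = 0 := c.2.2 t ht

theorem cons_comp_perm {X : Type*} {N : ℕ} (p : X) (t : Fin N → X) (σ : Equiv.Perm (Fin N)) :
    Fin.cons (α := fun _ => X) p (t ∘ σ) =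
      Fin.cons (α := fun _ => X) p t ∘ (Equiv.Perm.decomposeFin.symm (0, σ)) := by
  funext j
  refine Fin.cases ?_ (fun k => ?_) j <;> simp

open Classical in
/-- The boundary map, `∂ [p₀, …, p_k] = ∑ j, (-1) ^ j [p₀, …, p_{j-1}, p_{j+1}, …, p_k]`, where the
terms that are not orderings of cells (because some `α x` has become empty) are left out: the
coefficient of `[t]` in `∂ c` is the sum of the coefficients in `c` of all `[p, t]`. -/
noncomputable def boundary (G : FinGraph.{u}) (i : ℕ) :
    chains T R G (i + 1) →ₗ[R] chains T R G i where
  toFun c := ⟨fun t => if IsCellOrdering T G.graph t then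
      ∑ p : W × G.V, c.1 (Fin.cons (α := fun _ => W × G.V) p t) else 0, by
    refine ⟨fun σ t => ?_, fun t ht => if_neg ht⟩
    simp only [isCellOrdering_comp_perm]
    split_ifs with h
    · rw [Finset.mul_sum]
      refine Finset.sum_congr rfl fun p _ => ?_
      rw [cons_comp_perm]
      refine (chains_perm c _ _).trans ?_
      rw [Equiv.Perm.decomposeFin.symm_sign]
      simp
    · simp⟩
  map_add' a b := by
    ext t
    by_cases h : IsCellOrdering T G.graph t <;> simp [h, Finset.sum_add_distrib]
  map_smul' r a := by
    ext t
    by_cases h : IsCellOrdering T G.graph t <;> simp [h, Finset.mul_sum]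

open Classical in
/-- The map on chains induced by a graph homomorphism `f : G ⟶ H`. It sends the oriented cell
`[(x₀, a₀), …, (x_k, a_k)]` to `[(x₀, f a₀), …, (x_k, f a_k)]`, which is zero if there is a repetition
(then the image of the cell has smaller dimension). -/
noncomputable def mapChains {G H : FinGraph.{u}} (f : G ⟶ H) (i : ℕ) :
    chains T R G i →ₗ[R] chains T R H i where
  toFun c := ⟨fun t => ∑ s : Fin (Fintype.card W + i) → W × G.V,
      if Prod.map id (FinGraph.vmap f) ∘ s = t then c.1 s else 0, by
    refine ⟨fun σ t => ?_, fun t ht => ?_⟩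
    · rw [Finset.mul_sum]
      refine Fintype.sum_equiv (σ.arrowCongr (Equiv.refl _)) _ _ fun s => ?_
      have hs : s = (σ.arrowCongr (Equiv.refl (W × G.V)) s) ∘ σ := by
        funext j; simp [Equiv.arrowCongr]
      have hiff : Prod.map id (FinGraph.vmap f) ∘ s = t ∘ σ ↔
          Prod.map id (FinGraph.vmap f) ∘ (σ.arrowCongr (Equiv.refl (W × G.V)) s) = t := by
        constructor
        · intro h
          funext j
          simpa [Equiv.arrowCongr] using congrFun h (σ.symm j)
        · intro h
          rw [← h]
          funext j
          simp [Equiv.arrowCongr]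
      simp only [hiff, mul_ite, mul_zero]
      split_ifs
      · conv_lhs => rw [hs]
        exact chains_perm c _ _
      · rfl
    · by_cases hinj : Function.Injective t
      · refine Finset.sum_eq_zero fun s _ => ?_
        split_ifs with h
        · refine chains_eq_zero c s fun hs => ht ⟨hinj, ?_⟩
          rw [← h]
          exact hs.map f
        · rfl
      · simp only [Function.Injective, not_forall] at hinj
        obtain ⟨a, b, hab, hne⟩ := hinj
        refine Finset.sum_involution (fun s _ => s ∘ Equiv.swap a b) ?_ ?_ ?_ ?_
        · intro s _
          have hiff : Prod.map id (FinGraph.vmap f) ∘ (s ∘ Equiv.swap a b) = t ↔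
              Prod.map id (FinGraph.vmap f) ∘ s = t := by
            have ht' : t ∘ Equiv.swap a b = t := by
              funext j
              simp only [Function.comp, Equiv.swap_apply_def]
              split_ifs with h1 h2
              · rw [h1, hab]
              · rw [h2, hab]
              · rfl
            constructor
            · intro h
              rw [← ht', ← h]
              funext j
              simp
            · intro h
              rw [← ht', ← h]
              rfl
          simp only [hiff]
          split_ifs
          · rw [chains_perm c, Equiv.Perm.sign_swap hne]
            simp
          · simp
        · intro s _ hs heq
          refine hs ?_
          have hz : c.1 s = 0 := by
            refine chains_eq_zero c s fun hcell => hne (hcell.1 ?_)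
            have := congrFun heq a
            simpa using this.symm
          simp [hz]
        · intro s _
          exact Finset.mem_univ _
        · intro s _
          funext j
          simp⟩
  map_add' a b := by
    ext t
    simp only [Submodule.coe_add, Pi.add_apply, ← Finset.sum_add_distrib]
    refine Finset.sum_congr rfl fun s _ => ?_
    split_ifs <;> simp
  map_smul' r a := by
    ext t
    simp [Finset.mul_sum]

theorem boundary_apply (G : FinGraph.{u}) (i : ℕ) (c : chains T R G (i + 1))
    (t : Fin (Fintype.card W + i) → W × G.V) (ht : ∀ x, (listedSets t x).Nonempty) :
    (boundary G i c).1 t = ∑ p : W × G.V, c.1 (Fin.cons (α := fun _ => W × G.V) p t) := by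
  classical
  by_cases h : IsCellOrdering T G.graph t
  · exact if_pos h
  · refine (if_neg h).trans (Finset.sum_eq_zero fun p _ => ?_).symm
    exact chains_eq_zero c _ fun h' => h (h'.of_cons ht)

theorem boundary_boundary (G : FinGraph.{u}) (i : ℕ) (c : chains T R G (i + 1 + 1)) :
    boundary G i (boundary G (i + 1) c) = 0 := by
  ext t
  by_cases h : IsCellOrdering T G.graph t
  · rw [boundary_apply G i _ t h.2.1]
    have h2 : ∀ q : W × G.V, (boundary G (i + 1) c).1 (Fin.cons (α := fun _ => W × G.V) q t) =
        ∑ p : W × G.V, c.1 (Fin.cons (α := fun _ => W × G.V) p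
          (Fin.cons (α := fun _ => W × G.V) q t)) := by
      intro q
      refine boundary_apply G (i + 1) c (Fin.cons (α := fun _ => W × G.V) q t) fun x => ?_
      obtain ⟨a, j, hj⟩ := h.2.1 x
      exact ⟨a, Fin.succ j, hj⟩
    rw [Finset.sum_congr rfl fun q _ => h2 q, ← Fintype.sum_prod_type']
    refine Finset.sum_involution (fun q _ => q.swap) ?_ ?_ ?_ ?_
    · rintro ⟨q, p⟩ _
      have hs : Fin.cons (α := fun _ => W × G.V) q (Fin.cons (α := fun _ => W × G.V) p t) =
          Fin.cons (α := fun _ => W × G.V) p (Fin.cons (α := fun _ => W × G.V) q t) ∘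
            (Equiv.swap (0 : Fin (Fintype.card W + i + 1 + 1)) 1) := by
        funext j
        refine Fin.cases ?_ (fun k => ?_) j
        · simp
        · refine Fin.cases ?_ (fun l => ?_) k
          · simp
          · have : Equiv.swap (0 : Fin (Fintype.card W + i + 1 + 1)) 1 l.succ.succ = l.succ.succ :=
              Equiv.swap_apply_of_ne_of_ne (Fin.succ_ne_zero _)
                (fun h => Fin.succ_ne_zero l (Fin.succ_injective _ h))
            rw [Function.comp, this]
            simp
      have h3 := (congrArg c.1 hs).trans (chains_perm c
        (Equiv.swap (0 : Fin (Fintype.card W + i + 1 + 1)) 1) _)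
      rw [Equiv.Perm.sign_swap (by simp)] at h3
      simp only [Prod.swap]
      rw [h3]
      simp
    · rintro ⟨q, p⟩ _ hq heq
      have hpq : p = q := congrArg Prod.fst heq
      subst hpq
      refine hq (chains_eq_zero c _ fun hcell => ?_)
      have h01 := @hcell.1 (0 : Fin (Fintype.card W + i + 1 + 1)) (Fin.succ 0) rfl
      exact Fin.succ_ne_zero _ h01.symm
    · intro q _
      exact Finset.mem_univ _
    · intro q _
      simp
  · exact chains_eq_zero _ t h

theorem mapChains_boundary {G H : FinGraph.{u}} (f : G ⟶ H) (i : ℕ) (c : chains T R G (i + 1)) :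
    boundary H i (mapChains f (i + 1) c) = mapChains f i (boundary G i c) := by
  classical
  ext t
  by_cases h : IsCellOrdering T H.graph t
  · rw [boundary_apply H i _ t h.2.1]
    have hR : (mapChains f i (boundary G i c)).1 t =
        ∑ s : Fin (Fintype.card W + i) → W × G.V, ∑ q : W × G.V,
          if Prod.map id (FinGraph.vmap f) ∘ s = t then
            c.1 (Fin.cons (α := fun _ => W × G.V) q s) else 0 := by
      refine Finset.sum_congr rfl fun s _ => ?_
      split_ifs with hs
      · refine boundary_apply G i c s fun x => ?_
        obtain ⟨a, j, hj⟩ := h.2.1 x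
        rw [← hs] at hj
        have hj1 : (s j).1 = x := congrArg Prod.fst hj
        exact ⟨(s j).2, j, Prod.ext hj1 rfl⟩
      · simp
    have hL : ∀ p : W × H.V,
        (mapChains f (i + 1) c).1 (Fin.cons (α := fun _ => W × H.V) p t) =
        ∑ s : Fin (Fintype.card W + i) → W × G.V, ∑ q : W × G.V,
          if Prod.map id (FinGraph.vmap f) ∘ s = t then
            (if Prod.map id (FinGraph.vmap f) q = p then
              c.1 (Fin.cons (α := fun _ => W × G.V) q s) else 0) else 0 := by
      intro p
      refine ((Fin.consEquiv fun _ : Fin (Fintype.card W + i + 1) => W × G.V).sum_comp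
        (fun s' => if Prod.map id (FinGraph.vmap f) ∘ s' =
            Fin.cons (α := fun _ => W × H.V) p t then c.1 s' else 0)).symm.trans ?_
      rw [Fintype.sum_prod_type_right]
      refine Finset.sum_congr rfl fun s _ => Finset.sum_congr rfl fun q _ => ?_
      have hiff : Prod.map id (FinGraph.vmap f) ∘ Fin.cons (α := fun _ => W × G.V) q s =
          Fin.cons (α := fun _ => W × H.V) p t ↔
          Prod.map id (FinGraph.vmap f) ∘ s = t ∧ Prod.map id (FinGraph.vmap f) q = p := by
        constructor
        · intro h'
          exact ⟨funext fun j => congrFun h' j.succ, congrFun h' 0⟩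
        · rintro ⟨h1, h2⟩
          funext j
          refine Fin.cases ?_ (fun k => ?_) j
          · simpa using h2
          · simpa using congrFun h1 k
      change (if Prod.map id (FinGraph.vmap f) ∘ Fin.cons (α := fun _ => W × G.V) q s =
        Fin.cons (α := fun _ => W × H.V) p t then _ else _) = _
      simp only [hiff, ite_and]
      rfl
    rw [hR, Finset.sum_congr rfl fun p _ => hL p, Finset.sum_comm]
    refine Finset.sum_congr rfl fun s _ => ?_
    rw [Finset.sum_comm]
    refine Finset.sum_congr rfl fun q _ => ?_
    split_ifs <;> simp
  · rw [chains_eq_zero _ t h, chains_eq_zero _ t h]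

theorem mapChains_id (G : FinGraph.{u}) (i : ℕ) (c : chains T R G i) :
    mapChains (𝟙 G) i c = c := by
  classical
  ext t
  have : ∀ s : Fin (Fintype.card W + i) → W × G.V,
      Prod.map id (FinGraph.vmap (𝟙 G)) ∘ s = s := fun s => rfl
  simp [mapChains, this]

theorem mapChains_comp {G H K : FinGraph.{u}} (f : G ⟶ H) (g : H ⟶ K) (i : ℕ)
    (c : chains T R G i) :
    mapChains (f ≫ g) i c = mapChains g i (mapChains f i c) := by
  classical
  ext t
  have hc : ∀ s : Fin (Fintype.card W + i) → W × G.V,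
      Prod.map id (FinGraph.vmap (f ≫ g)) ∘ s =
        Prod.map id (FinGraph.vmap g) ∘ (Prod.map id (FinGraph.vmap f) ∘ s) := fun s => rfl
  have hL : (mapChains (f ≫ g) i c).1 t = ∑ s : Fin (Fintype.card W + i) → W × G.V,
      if Prod.map id (FinGraph.vmap g) ∘ (Prod.map id (FinGraph.vmap f) ∘ s) = t
        then c.1 s else 0 := rfl
  have hR : (mapChains g i (mapChains f i c)).1 t =
      ∑ r : Fin (Fintype.card W + i) → W × H.V,
        if Prod.map id (FinGraph.vmap g) ∘ r = t then
          ∑ s : Fin (Fintype.card W + i) → W × G.V,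
            (if Prod.map id (FinGraph.vmap f) ∘ s = r then c.1 s else 0) else 0 := by
    simp [mapChains]
  have hr : ∀ r : Fin (Fintype.card W + i) → W × H.V,
      (if Prod.map id (FinGraph.vmap g) ∘ r = t then
        ∑ s : Fin (Fintype.card W + i) → W × G.V,
          (if Prod.map id (FinGraph.vmap f) ∘ s = r then c.1 s else 0) else 0) =
      ∑ s : Fin (Fintype.card W + i) → W × G.V,
        (if Prod.map id (FinGraph.vmap f) ∘ s = r then
          (if Prod.map id (FinGraph.vmap g) ∘ r = t then c.1 s else 0) else 0) := by
    intro r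
    split_ifs <;> simp
  rw [hL, hR, Finset.sum_congr rfl fun r _ => hr r, Finset.sum_comm]
  refine Finset.sum_congr rfl fun s _ => ?_
  rw [Finset.sum_ite_eq]
  simp

variable (T R) in
/-- The cellular chain complex of the Hom-complex of `T` and `G` with coefficients in `R`, as a
functor of `G`. -/
noncomputable def chainComplex :
    FinGraph.{u} ⥤ ChainComplex (ModuleCat.{max u v w} R) ℕ where
  obj G := ChainComplex.of (fun i => ModuleCat.of R (chains T R G i))
    (fun i => ModuleCat.ofHom (boundary G i))
    (fun i => by
      apply ModuleCat.hom_ext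
      exact LinearMap.ext fun c => boundary_boundary G i c)
  map {G H} f := ChainComplex.ofHom (fun i => ModuleCat.ofHom (mapChains f i)) (fun i => by
    simp only [ChainComplex.of_d]
    apply ModuleCat.hom_ext
    exact LinearMap.ext fun c => mapChains_boundary f i c)
  map_id G := by
    refine HomologicalComplex.hom_ext _ _ fun i => ModuleCat.hom_ext ?_
    exact LinearMap.ext fun c => mapChains_id G i c
  map_comp f g := by
    refine HomologicalComplex.hom_ext _ _ fun i => ModuleCat.hom_ext ?_
    exact LinearMap.ext fun c => mapChains_comp f g i c

end HomComplex

end HomComplex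

/-- The `FI`-module `H_i(X_n)` of a functor `X` from `FI` to chain complexes. -/
noncomputable def FIModule.homology {R : Type w} [CommRing R]
    (X : FI ⥤ ChainComplex (ModuleCat.{u} R) ℕ) (i : ℕ) : FI ⥤ ModuleCat.{u} R :=
  X ⋙ HomologicalComplex.homologyFunctor _ _ i

/-- The functor that sends `n` to the cellular chain complex, with coefficients in `R`, of the
Hom-complex of `T` and `G_n`. -/
noncomputable def homComplexChains {W : Type v} [Fintype W] (T : SimpleGraph W)
    (G : FI ⥤ FinGraph.{u}) (R : Type w) [CommRing R] :
    FI ⥤ ChainComplex (ModuleCat.{max u v w} R) ℕ :=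
  G ⋙ HomComplex.chainComplex T R

/-- The functor `n ↦ Hom(T, G_n)` is representation stable: for every `i`, the `FI`-module over `ℤ`
of the `i`-th integral homology groups is finitely generated. -/
def HomComplexRepresentationStable {W : Type v} [Fintype W] (T : SimpleGraph W)
    (G : FI ⥤ FinGraph.{u}) : Prop :=
  ∀ i : ℕ, FIModule.FG (FIModule.homology (homComplexChains T G ℤ) i)

/-! An oriented `i`-cell is a tuple of `|V(T)| + i` pairs `(x, a)`, up to even permutation. Hence
the `i`-chains are alternating functions on such tuples, and they form a sub-FI-module of the module
of all functions on tuples (`chainsToTuples`). The latter is generated in bounded degree: by vertex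
stability each vertex comes from at most `d` points, so a tuple of `N` pairs comes from the union of
`N` such subsets, of size at most `N * d` (`fgInDegree_tupleModule`). Homology is a quotient of the
cycles, hence a subquotient of this module (`isSubquotient_homology`), and `|V(T)| + i ≤ (i + 1)
|V(T)|` for nonempty `T` gives the bound.

Finite generation of the subquotient is Noetherianity of FI-modules over a Noetherian ring
(`exists_finite_le_spanImages`), shown by a Gröbner basis argument. Monomials, which are injections
labelled by a generator, are ordered lexicographically. Divisibility is restricted to
order-preserving injections, which respect this order, and is a well-quasi-order by Higman's lemma.
A submodule is determined by its ideals of leading coefficients, and these are governed by finitely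
many monomials.

For the dimensions, the cokernel of `V_n → V_{n+1}` is generated in lower degree, and its kernel
vanishes eventually by Noetherianity. Induction makes the dimension eventually polynomial
(`exists_sum_choose_finrank`). For a small module the degree is bounded by comparison with the
ambient module. -/

/-! ### Monomials and their well-quasi-ordering -/

namespace FIModule

/-- A basis element of the degree `n` part of the free `FI`-module on generators of degrees `m j`. -/
abbrev Monomial {k : ℕ} (m : Fin k → ℕ) (n : ℕ) := Σ j, Fin (m j) ↪ Fin n

namespace Monomial

variable {k : ℕ} {m : Fin k → ℕ} {n n' : ℕ}

/-- The action of an injection on monomials. -/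
def push (g : Fin n ↪ Fin n') (μ : Monomial m n) : Monomial m n' := ⟨μ.1, μ.2.trans g⟩

/-- The values of an injection, extended by zero. -/
def pad {a b : ℕ} (f : Fin a ↪ Fin b) (i : ℕ) : ℕ := if h : i < a then f ⟨i, h⟩ else 0

theorem pad_of_lt {a b : ℕ} (f : Fin a ↪ Fin b) {i : ℕ} (h : i < a) : pad f i = f ⟨i, h⟩ :=
  dif_pos h

theorem pad_of_not_lt {a b : ℕ} (f : Fin a ↪ Fin b) {i : ℕ} (h : ¬ i < a) : pad f i = 0 :=
  dif_neg h

/-- The position of a monomial in the monomial order. -/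
def key (μ : Monomial m n) : Fin k ×ₗ Lex (ℕ → ℕ) := toLex (μ.1, toLex (pad μ.2))

theorem key_injective : Function.Injective (key : Monomial m n → _) := by
  rintro ⟨j, f⟩ ⟨j', f'⟩ h
  obtain ⟨h1, h2⟩ := Prod.ext_iff.1 (toLex.injective h)
  obtain rfl : j = j' := h1
  congr 1
  ext ⟨i, hi⟩
  simpa [pad_of_lt _ hi] using congrFun (toLex.injective h2) i

/-- A strictly monotone map preserves the first difference of two value sequences and its sign. A
general injection does not, which is why divisibility uses order embeddings only. -/
theorem key_push_lt {g : Fin n ↪ Fin n'} (hg : StrictMono g) {μ ν : Monomial m n}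
    (h : μ.key < ν.key) : (μ.push g).key < (ν.push g).key := by
  obtain ⟨j, f⟩ := μ
  obtain ⟨j', f'⟩ := ν
  rw [key, key, Prod.Lex.toLex_lt_toLex] at h ⊢
  refine h.imp id ?_
  rintro ⟨h1, i, hi, hlt⟩
  obtain rfl : j = j' := h1
  refine ⟨rfl, i, fun a ha => ?_, ?_⟩
  · have := hi a ha
    by_cases ham : a < m j
    · change pad f a = pad f' a at this
      change pad (f.trans g) a = pad (f'.trans g) a
      rw [pad_of_lt _ ham, pad_of_lt _ ham] at this ⊢
      exact congrArg (fun b => (g b : ℕ)) (Fin.ext this)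
    · exact (pad_of_not_lt _ ham).trans (pad_of_not_lt _ ham).symm
  · change pad f i < pad f' i at hlt
    change pad (f.trans g) i < pad (f'.trans g) i
    by_cases him : i < m j
    · rw [pad_of_lt _ him, pad_of_lt _ him] at hlt ⊢
      exact hg hlt
    · simp [pad_of_not_lt _ him] at hlt

open Classical in
/-- The word of length `n` that has a letter for `a` at position `f a` and blanks elsewhere. -/
noncomputable def word (μ : Monomial m n) : List (Option (Σ j, Fin (m j))) :=
  List.ofFn fun i => if h : ∃ a, μ.2 a = i then some ⟨μ.1, h.choose⟩ else none

/-- A sublist is an order embedding of positions that preserves letters, so it carries the position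
of each `a` in the first word to its position in the second. Equality of generators is a separate
hypothesis because a generator of degree `0` leaves no letter in its word. -/
theorem exists_push_eq_of_word_sublist {μ : Monomial m n} {ν : Monomial m n'} (h : μ.1 = ν.1)
    (hw : μ.word.Sublist ν.word) : ∃ g : Fin n ↪o Fin n', μ.push g.toEmbedding = ν := by
  classical
  obtain ⟨j, f⟩ := μ
  obtain ⟨j', f'⟩ := ν
  obtain rfl : j = j' := h
  obtain ⟨g, hg⟩ := List.sublist_iff_exists_fin_orderEmbedding_get_eq.1 hw
  have h1 : (word ⟨j, f⟩).length = n := by simp [word]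
  have h2 : (word ⟨j, f'⟩).length = n' := by simp [word]
  refine ⟨(Fin.castOrderIso h1.symm).toOrderEmbedding.trans
    (g.trans (Fin.castOrderIso h2).toOrderEmbedding), ?_⟩
  refine Sigma.ext rfl (heq_of_eq ?_)
  ext a : 1
  have hL : ∀ (f : Fin (m j) ↪ Fin n) (h : ∃ b, f b = f a), h.choose = a :=
    fun f h => f.injective h.choose_spec
  have := hg (Fin.cast h1.symm (f a))
  simp only [word, List.get_ofFn] at this
  rw [dif_pos ⟨a, rfl⟩] at this
  have h3 := Option.dite_none_right_eq_some.1 this.symm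
  obtain ⟨h3, h4⟩ := h3
  have h5 := h3.choose_spec
  have h6 : h3.choose = a := by
    have := eq_of_heq (Sigma.mk.inj (Option.some.inj h4)).2
    exact this.trans (hL f _)
  rw [h6] at h5
  exact h5.symm

/-- Divisibility of monomials: one is the image of the other under an order embedding. -/
def Dvd (μ ν : Σ n, Monomial m n) : Prop := ∃ g : Fin μ.1 ↪o Fin ν.1, μ.2.push g.toEmbedding = ν.2

instance : IsPreorder (Σ n, Monomial m n) Dvd where
  refl μ := ⟨RelEmbedding.refl _, rfl⟩
  trans μ ν ρ := by
    rintro ⟨g, hg⟩ ⟨g', hg'⟩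
    exact ⟨g.trans g', by rw [← hg', ← hg]; rfl⟩

/-- Higman's lemma for a finite alphabet compared by equality. -/
theorem wellQuasiOrdered_sublist (α : Type*) [Finite α] :
    WellQuasiOrdered (List.Sublist : List α → List α → Prop) := by
  have h := Set.PartiallyWellOrderedOn.partiallyWellOrderedOn_sublistForall₂ (α := α) (· = ·)
    (s := Set.univ) (Set.partiallyWellOrderedOn_univ_iff.2 (Finite.wellQuasiOrdered _))
  intro f
  obtain ⟨a, b, hab, hr⟩ := h.exists_lt (f := f) (by simp)
  refine ⟨a, b, hab, ?_⟩
  obtain ⟨l, hl, hs⟩ := List.sublistForall₂_iff.1 hr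
  rw [List.forall₂_eq_eq_eq] at hl
  exact hl ▸ hs

theorem wellQuasiOrdered_dvd : WellQuasiOrdered (Dvd : (Σ n, Monomial m n) → _ → Prop) := by
  intro f
  obtain ⟨a, b, hab, h1, h2⟩ := (Finite.wellQuasiOrdered (Eq : Fin k → Fin k → Prop)).prod
    (wellQuasiOrdered_sublist (Option (Σ j, Fin (m j)))) fun i => ((f i).2.1, (f i).2.word)
  exact ⟨a, b, hab, exists_push_eq_of_word_sublist h1 h2⟩

end Monomial

/-! ### Finite bases of well-quasi-orders -/

theorem exists_finite_basis_of_wellQuasiOrdered {α : Type*} {r : α → α → Prop}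
    (h : WellQuasiOrdered r) : ∃ B : Set α, B.Finite ∧ ∀ a, a ∈ B ∨ ∃ b ∈ B, r b a := by
  by_contra! hB
  -- If no finite set works, each new term can be chosen above none of the earlier ones, which
  -- builds a bad sequence.
  obtain ⟨f, -, hf⟩ := exists_seq_of_forall_finset_exists (fun _ : α => True)
    (fun a b => ¬ r a b) (fun s _ => by
      obtain ⟨a, -, ha⟩ := hB s s.finite_toSet
      exact ⟨a, trivial, ha⟩)
  obtain ⟨a, b, hab, hr⟩ := h f
  exact hf a b hab hr

/-- A monotone map from a well-quasi-order to the ideals of a Noetherian ring has finitely many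
values up to divisibility. -/
theorem wellQuasiOrdered_and_eq {α R : Type*} [CommRing R] [IsNoetherianRing R] {r : α → α → Prop}
    [IsPreorder α r] (h : WellQuasiOrdered r) (I : α → Ideal R) (hI : ∀ a b, r a b → I a ≤ I b) :
    WellQuasiOrdered fun a b => r a b ∧ I a = I b := by
  intro f
  -- Along a monotone subsequence the ideals ascend, hence stabilise.
  obtain ⟨g, hg⟩ := h.exists_monotone_subseq f
  obtain ⟨n, hn⟩ := (monotone_stabilizes_iff_noetherian (R := R) (M := R)).2 inferInstance
    ⟨fun i => I (f (g i)), fun a b hab => hI _ _ (hg a b hab)⟩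
  exact ⟨g n, g (n + 1), g.strictMono n.lt_succ_self, hg _ _ n.le_succ, hn (n + 1) n.le_succ⟩

/-! ### Noetherianity -/

variable {R : Type w} [CommRing R] {V : FI ⥤ ModuleCat.{u} R}

/-- The submodule of `V_n` spanned by the images of the elements of `S`. -/
def spanImages (S : Set (Σ m : FI, V.obj m)) (n : FI) : Submodule R (V.obj n) :=
  Submodule.span R {y | ∃ s ∈ S, ∃ f : s.1 ⟶ n, (V.map f).hom s.2 = y}

theorem map_mem_spanImages {S : Set (Σ m : FI, V.obj m)} {n n' : FI} (g : n ⟶ n') {x : V.obj n}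
    (hx : x ∈ spanImages S n) : (V.map g).hom x ∈ spanImages S n' := by
  have : spanImages S n ≤ (spanImages S n').comap (V.map g).hom := by
    refine Submodule.span_le.2 ?_
    rintro _ ⟨s, hs, f, rfl⟩
    exact Submodule.subset_span ⟨s, hs, f ≫ g, by simp⟩
  exact this hx

theorem mem_spanImages {S : Set (Σ m : FI, V.obj m)} {n : FI} {x : V.obj n} (hx : ⟨n, x⟩ ∈ S) :
    x ∈ spanImages S n :=
  Submodule.subset_span ⟨⟨n, x⟩, hx, 𝟙 n, by simp⟩

theorem spanImages_le {S : Set (Σ m : FI, V.obj m)} {A : ∀ n, Submodule R (V.obj n)}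
    (hA : ∀ ⦃n n' : FI⦄ (g : n ⟶ n') (x : V.obj n), x ∈ A n → (V.map g).hom x ∈ A n')
    (hS : ∀ s ∈ S, s.2 ∈ A s.1) (n : FI) : spanImages S n ≤ A n := by
  refine Submodule.span_le.2 ?_
  rintro _ ⟨s, hs, f, rfl⟩
  exact hA f _ (hS s hs)

/-! ### Leading terms and leading ideals -/

section Noetherian

variable {k : ℕ} (g : Fin k → Σ m : FI, V.obj m)

/-- The element of `V_n` given by a monomial in the generators. -/
def monomialValue (n : FI) (μ : Monomial (fun j => (g j).1.card) n.card) : V.obj n :=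
  (V.map (show (g μ.1).1 ⟶ n from μ.2)).hom (g μ.1).2

/-- The span of the values of the monomials that precede `μ`. -/
def lowerSpan (n : FI) (μ : Monomial (fun j => (g j).1.card) n.card) : Submodule R (V.obj n) :=
  Submodule.span R {y | ∃ ν, Monomial.key ν < μ.key ∧ monomialValue g n ν = y}

theorem monomialValue_push {n n' : FI} (f : n ⟶ n')
    (μ : Monomial (fun j => (g j).1.card) n.card) :
    monomialValue g n' (μ.push f) = (V.map f).hom (monomialValue g n μ) := by
  have : (V.map ((show (g μ.1).1 ⟶ n from μ.2) ≫ f)).hom (g μ.1).2 =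
    (V.map f).hom ((V.map (show (g μ.1).1 ⟶ n from μ.2)).hom (g μ.1).2) := by simp
  exact this

theorem map_mem_lowerSpan {n n' : FI} (f : Fin n.card ↪o Fin n'.card)
    (μ : Monomial (fun j => (g j).1.card) n.card) {x : V.obj n} (hx : x ∈ lowerSpan g n μ) :
    (V.map (show n ⟶ n' from f.toEmbedding)).hom x ∈
      lowerSpan g n' (μ.push f.toEmbedding) := by
  have : lowerSpan g n μ ≤ (lowerSpan g n' (μ.push f.toEmbedding)).comap
      (V.map (show n ⟶ n' from f.toEmbedding)).hom := by
    refine Submodule.span_le.2 ?_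
    rintro _ ⟨ν, hν, rfl⟩
    exact Submodule.subset_span ⟨ν.push f.toEmbedding,
      Monomial.key_push_lt (g := f.toEmbedding) f.strictMono hν, monomialValue_push g _ ν⟩
  exact this hx

/-- The ideal of the leading coefficients at `μ` of the elements of `A`. -/
def leadIdeal (A : ∀ n, Submodule R (V.obj n)) (n : FI)
    (μ : Monomial (fun j => (g j).1.card) n.card) : Ideal R :=
  (A n ⊔ lowerSpan g n μ).comap (LinearMap.toSpanSingleton R _ (monomialValue g n μ))

theorem mem_leadIdeal {A : ∀ n, Submodule R (V.obj n)} {n : FI}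
    {μ : Monomial (fun j => (g j).1.card) n.card} {r : R} :
    r ∈ leadIdeal g A n μ ↔
      ∃ a ∈ A n, ∃ l ∈ lowerSpan g n μ, a + l = r • monomialValue g n μ := by
  rw [leadIdeal, Submodule.mem_comap, LinearMap.toSpanSingleton_apply, Submodule.mem_sup]

theorem leadIdeal_push {A : ∀ n, Submodule R (V.obj n)}
    (hA : ∀ ⦃n n' : FI⦄ (g : n ⟶ n') (x : V.obj n), x ∈ A n → (V.map g).hom x ∈ A n')
    {n n' : FI} (f : Fin n.card ↪o Fin n'.card)
    (μ : Monomial (fun j => (g j).1.card) n.card) :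
    leadIdeal g A n μ ≤ leadIdeal g A n' (μ.push f.toEmbedding) := by
  intro r hr
  obtain ⟨a, ha, l, hl, h⟩ := (mem_leadIdeal g).1 hr
  refine (mem_leadIdeal g).2 ⟨_, hA (show n ⟶ n' from f.toEmbedding) a ha, _,
    map_mem_lowerSpan g f μ hl, ?_⟩
  have h1 := monomialValue_push g (show n ⟶ n' from f.toEmbedding) μ
  rw [h1, ← map_add, h, map_smul]

/-- Existence of a leading term, chosen among the monomials allowed by `P`. It is not unique, and
`r` may vanish, since the values of monomials in `V` can satisfy relations. This lets the argument
run in `V` itself, without a free cover. -/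
theorem eq_zero_or_exists_of_mem_span {n : FI}
    (P : Monomial (fun j => (g j).1.card) n.card → Prop) {x : V.obj n}
    (hx : x ∈ Submodule.span R {y | ∃ ν, P ν ∧ monomialValue g n ν = y}) :
    x = 0 ∨ ∃ ν, P ν ∧ ∃ r : R, ∃ l ∈ lowerSpan g n ν, x = r • monomialValue g n ν + l := by
  have key : ∀ ν ρ, Monomial.key ν < ρ.key → ∀ (r : R), ∀ l ∈ lowerSpan g n ν,
      r • monomialValue g n ν + l ∈ lowerSpan g n ρ := by
    intro ν ρ h r l hl
    refine add_mem (Submodule.smul_mem _ _ (Submodule.subset_span ⟨ν, h, rfl⟩)) ?_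
    refine Submodule.span_mono ?_ hl
    rintro _ ⟨σ, hσ, rfl⟩
    exact ⟨σ, hσ.trans h, rfl⟩
  induction hx using Submodule.span_induction with
  | mem x hx =>
    obtain ⟨ν, hν, rfl⟩ := hx
    exact Or.inr ⟨ν, hν, 1, 0, zero_mem _, by simp⟩
  | zero => exact Or.inl rfl
  | add x y _ _ hx hy =>
    rcases hx with rfl | ⟨ν, hν, r, l, hl, rfl⟩
    · simpa using hy
    rcases hy with rfl | ⟨ρ, hρ, s, l', hl', rfl⟩
    · exact Or.inr ⟨ν, hν, r, l, hl, by simp⟩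
    right
    rcases lt_trichotomy ν.key ρ.key with h | h | h
    · exact ⟨ρ, hρ, s, _, add_mem (key ν ρ h r l hl) hl', by abel⟩
    · obtain rfl := Monomial.key_injective h
      exact ⟨ν, hν, r + s, _, add_mem hl hl', by rw [add_smul]; abel⟩
    · exact ⟨ν, hν, r, _, add_mem hl (key ρ ν h s l' hl'), by abel⟩
  | smul c x _ hx =>
    rcases hx with rfl | ⟨ν, hν, r, l, hl, rfl⟩
    · simp
    · exact Or.inr ⟨ν, hν, c * r, c • l, Submodule.smul_mem _ _ hl, by simp [smul_smul]⟩

/-- Submodules of a submodule with the same leading ideals agree with it. -/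
theorem le_of_leadIdeal_le (hg : ∀ n, spanImages (Set.range g) n = ⊤)
    {A A' : ∀ n, Submodule R (V.obj n)} (h : ∀ n, A' n ≤ A n)
    (hI : ∀ n μ, leadIdeal g A n μ ≤ leadIdeal g A' n μ) (n : FI) : A n ≤ A' n := by
  have hfin : Finite (Monomial (fun j => (g j).1.card) n.card) := inferInstance
  have main : ∀ ν : Monomial (fun j => (g j).1.card) n.card, ∀ x ∈ A n, ∀ r : R,
      ∀ l ∈ lowerSpan g n ν, x = r • monomialValue g n ν + l → x ∈ A' n := by
    intro ν
    -- The order on keys need not be well-founded, but in each degree there are only finitely many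
    -- monomials.
    have hwf := Finite.wellFounded_of_trans_of_irrefl
      (InvImage (· < ·) (Monomial.key : Monomial (fun j => (g j).1.card) n.card → _))
    induction ν using hwf.induction with
    | _ ν ih =>
    intro x hx r l hl hxl
    -- Some `a` in `A'` has the same leading coefficient at `ν` as `x`; subtracting it leaves an
    -- element of `A` in the span of smaller monomials.
    obtain ⟨a, ha, l', hl', e⟩ := (mem_leadIdeal g).1 (hI n ν
      ((mem_leadIdeal g).2 ⟨x, hx, -l, neg_mem hl, by rw [hxl]; abel⟩))
    have hd : x - a ∈ lowerSpan g n ν := by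
      rw [hxl, ← e, show a + l' + l - a = l' + l by abel]
      exact add_mem hl' hl
    rw [← sub_add_cancel x a]
    refine add_mem ?_ ha
    rcases eq_zero_or_exists_of_mem_span g _ hd with h0 | ⟨ρ, hρ, s, l'', hl'', e'⟩
    · rw [h0]; exact zero_mem _
    · exact ih ρ hρ _ (sub_mem hx (h n ha)) s l'' hl'' e'
  intro x hx
  have hx' : x ∈ Submodule.span R {y | ∃ ν, True ∧ monomialValue g n ν = y} := by
    have : x ∈ spanImages (Set.range g) n := by rw [hg]; trivial
    refine Submodule.span_mono ?_ this
    rintro _ ⟨_, ⟨j, rfl⟩, f, rfl⟩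
    exact ⟨⟨j, f⟩, trivial, rfl⟩
  rcases eq_zero_or_exists_of_mem_span g _ hx' with h0 | ⟨ρ, -, s, l, hl, e⟩
  · rw [h0]; exact zero_mem _
  · exact main ρ x hx s l hl e

end Noetherian

/-- Submodules of finitely generated `FI`-modules over Noetherian rings are finitely generated. -/
theorem exists_finite_le_spanImages [IsNoetherianRing R] (hV : FG V)
    (A : ∀ n, Submodule R (V.obj n))
    (hA : ∀ ⦃n n' : FI⦄ (g : n ⟶ n') (x : V.obj n), x ∈ A n → (V.map g).hom x ∈ A n') :
    ∃ S : Set (Σ m : FI, V.obj m), S.Finite ∧ (∀ s ∈ S, s.2 ∈ A s.1) ∧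
      ∀ n, A n ≤ spanImages S n := by
  obtain ⟨d, S₀, hS₀, -, hspan⟩ := hV
  obtain ⟨k, g, -, rfl⟩ := hS₀.fin_param
  let I : (Σ n, Monomial (fun j => (g j).1.card) n) → Ideal R := fun μ => leadIdeal g A ⟨μ.1⟩ μ.2
  have hI : ∀ μ ν, Monomial.Dvd μ ν → I μ ≤ I ν := by
    rintro ⟨n, μ⟩ ⟨n', ν⟩ ⟨(f : Fin n ↪o Fin n'), hf⟩
    obtain rfl : ν = μ.push f.toEmbedding := hf.symm
    exact leadIdeal_push g hA (n := ⟨n⟩) (n' := ⟨n'⟩) f μ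
  obtain ⟨B, hB, hBI⟩ := exists_finite_basis_of_wellQuasiOrdered
    (wellQuasiOrdered_and_eq Monomial.wellQuasiOrdered_dvd I hI)
  have hBI' : ∀ μ, ∃ b ∈ B, Monomial.Dvd b μ ∧ I b = I μ := by
    intro μ
    rcases hBI μ with h | h
    · exact ⟨μ, h, refl_of _ μ, rfl⟩
    · exact h
  -- Each leading ideal is finitely generated, so finitely many elements of `A` realise all its
  -- coefficients.
  have hfg : ∀ b : Σ n, Monomial (fun j => (g j).1.card) n, ∃ T : Set (Σ m : FI, V.obj m),
      T.Finite ∧ (∀ s ∈ T, s.2 ∈ A s.1) ∧ I b ≤ leadIdeal g (spanImages T) ⟨b.1⟩ b.2 := by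
    rintro ⟨n, μ⟩
    obtain ⟨G, hG⟩ := IsNoetherian.noetherian (R := R) (I ⟨n, μ⟩)
    have hmem : ∀ r : G, ∃ a ∈ A ⟨n⟩, ∃ l ∈ lowerSpan g ⟨n⟩ μ,
        a + l = (r : R) • monomialValue g ⟨n⟩ μ := fun r =>
      (mem_leadIdeal g).1 (show (r : R) ∈ I ⟨n, μ⟩ from hG ▸ Submodule.subset_span r.2)
    choose a ha l hl e using hmem
    refine ⟨Set.range fun r : G => ⟨⟨n⟩, a r⟩, Set.finite_range _, ?_, ?_⟩
    · rintro _ ⟨r, rfl⟩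
      exact ha r
    · rw [← hG]
      refine Submodule.span_le.2 fun r hr => ?_
      exact (mem_leadIdeal g).2 ⟨a ⟨r, hr⟩, mem_spanImages ⟨_, rfl⟩, l ⟨r, hr⟩, hl _, e ⟨r, hr⟩⟩
  choose T hT hTA hTI using hfg
  have hS : ∀ s ∈ ⋃ b ∈ B, T b, s.2 ∈ A s.1 := by
    intro s hs
    obtain ⟨b, hb, hs⟩ := Set.mem_iUnion₂.1 hs
    exact hTA b s hs
  refine ⟨⋃ b ∈ B, T b, hB.biUnion fun b _ => hT b, hS,
    le_of_leadIdeal_le g hspan (spanImages_le hA hS) fun n μ => ?_⟩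
  -- The ideal at `μ` equals the one at a basis monomial `b` dividing it; the elements realising the
  -- latter, pushed along `f`, realise the former.
  obtain ⟨b, hb, ⟨f, hf⟩, hbI⟩ := hBI' ⟨n.card, μ⟩
  change Fin b.1 ↪o Fin n.card at f
  obtain rfl : μ = b.2.push f.toEmbedding := hf.symm
  refine (show I ⟨n.card, _⟩ ≤ _ from hbI ▸ hTI b).trans ?_
  refine le_trans ?_ (leadIdeal_push g (fun _ _ f x hx => map_mem_spanImages f hx)
    (n := ⟨b.1⟩) f b.2)
  refine Submodule.comap_mono (sup_le_sup_right (Submodule.span_mono ?_) _)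
  rintro _ ⟨s, hs, f, rfl⟩
  exact ⟨s, Set.mem_biUnion hb hs, f, rfl⟩

/-! ### Finite generation of quotients, submodules and subquotients -/

theorem FGInDegree.of_surjective {V Q : FI ⥤ ModuleCat.{u} R} (π : V ⟶ Q)
    (hπ : ∀ n, Function.Surjective (π.app n).hom) {d : ℕ} (hV : FGInDegree V d) :
    FGInDegree Q d := by
  obtain ⟨S, hS, hSd, hspan⟩ := hV
  refine ⟨(fun s : Σ m : FI, V.obj m => (⟨s.1, (π.app s.1).hom s.2⟩ : Σ m : FI, Q.obj m)) '' S,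
    hS.image _, ?_, fun n => ?_⟩
  · rintro _ ⟨s, hs, rfl⟩
    exact hSd s hs
  · rw [eq_top_iff, ← LinearMap.range_eq_top.2 (hπ n), LinearMap.range_eq_map, ← hspan n,
      Submodule.map_span]
    refine Submodule.span_mono ?_
    rintro _ ⟨_, ⟨s, hs, f, rfl⟩, rfl⟩
    refine ⟨_, ⟨s, hs, rfl⟩, f, ?_⟩
    exact (ConcreteCategory.congr_hom (π.naturality f) s.2).symm

theorem FG.of_injective [IsNoetherianRing R] {A V : FI ⥤ ModuleCat.{u} R} (ι : A ⟶ V)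
    (hι : ∀ n, Function.Injective (ι.app n).hom) (hV : FG V) : FG A := by
  have hnat : ∀ {n n' : FI} (f : n ⟶ n') (x : A.obj n),
      (V.map f).hom ((ι.app n).hom x) = (ι.app n').hom ((A.map f).hom x) := fun f x =>
    (ConcreteCategory.congr_hom (ι.naturality f) x).symm
  obtain ⟨S, hS, hSA, hle⟩ := exists_finite_le_spanImages hV
    (fun n => LinearMap.range (ι.app n).hom) (by
      rintro n n' f _ ⟨x, rfl⟩
      exact ⟨(A.map f).hom x, (hnat f x).symm⟩)
  let e : (Σ m : FI, A.obj m) → Σ m : FI, V.obj m := fun s => ⟨s.1, (ι.app s.1).hom s.2⟩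
  have he : Function.Injective e := by
    rintro ⟨m, x⟩ ⟨m', x'⟩ h
    obtain rfl : m = m' := congrArg Sigma.fst h
    exact congrArg _ (hι m (eq_of_heq (Sigma.mk.inj h).2))
  have hS' : (e ⁻¹' S).Finite := hS.preimage he.injOn
  -- This degree is unrelated to that of `V`: Noetherianity gives finitely many generators but no
  -- bound on their degrees.
  obtain ⟨d, hd⟩ := (hS'.image fun s => s.1.card).bddAbove
  refine ⟨d, e ⁻¹' S, hS', fun s hs => hd ⟨s, hs, rfl⟩, fun n => ?_⟩
  rw [eq_top_iff]
  intro x _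
  have hx : (ι.app n).hom x ∈ spanImages S n := hle n ⟨x, rfl⟩
  have hle' : spanImages S n ≤ (spanImages (e ⁻¹' S) n).map (ι.app n).hom := by
    refine Submodule.span_le.2 ?_
    rintro _ ⟨⟨m, y⟩, hs, (f : m ⟶ n), rfl⟩
    obtain ⟨z, hz⟩ := hSA _ hs
    change (ι.app m).hom z = y at hz
    refine ⟨(A.map f).hom z, Submodule.subset_span ⟨⟨m, z⟩, ?_, f, rfl⟩, ?_⟩
    · change (⟨m, (ι.app m).hom z⟩ : Σ m : FI, V.obj m) ∈ S
      rwa [hz]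
    · rw [← hnat f z, hz]
  obtain ⟨y, hy, hyx⟩ := hle' hx
  rw [← hι n hyx]
  exact hy

theorem IsSubquotient.fg [IsNoetherianRing R] {V W : FI ⥤ ModuleCat.{u} R}
    (h : IsSubquotient V W) (hW : FG W) : FG V := by
  obtain ⟨A, ι, π, hι, hπ⟩ := h
  obtain ⟨d, hd⟩ := hW.of_injective ι hι
  exact ⟨d, hd.of_surjective π hπ⟩

end FIModule

/-! ### The derivative of an `FI`-module and the growth of dimensions -/

namespace FI

/-- The inclusion of `[n]` in `[n + 1]` that misses the first element. -/
def succ (n : FI) : n ⟶ ⟨n.card + 1⟩ := Fin.succEmb n.card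

/-- The extension of an injection by a new first element. -/
def shift {m n : FI} (f : m ⟶ n) : (⟨m.card + 1⟩ : FI) ⟶ ⟨n.card + 1⟩ :=
  (⟨Fin.cases 0 fun i => ((show Fin m.card ↪ Fin n.card from f) i).succ, by
    intro a b
    refine Fin.cases ?_ (fun a => ?_) a <;> refine Fin.cases ?_ (fun b => ?_) b
    · simp
    · intro h
      exact absurd h.symm (Fin.succ_ne_zero _)
    · intro h
      exact absurd h (Fin.succ_ne_zero _)
    · intro h
      exact congrArg Fin.succ (Function.Embedding.injective _ (Fin.succ_injective _ h))⟩ :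
    Fin (m.card + 1) ↪ Fin (n.card + 1))

theorem hom_ext {m n : FI} {f g : m ⟶ n}
    (h : ∀ i, (show Fin m.card ↪ Fin n.card from f) i = (show Fin m.card ↪ Fin n.card from g) i) :
    f = g :=
  DFunLike.ext (F := Fin m.card ↪ Fin n.card) f g h

theorem succ_comp_shift {m n : FI} (f : m ⟶ n) : succ m ≫ shift f = f ≫ succ n := rfl

theorem shift_id (n : FI) : shift (𝟙 n) = 𝟙 _ :=
  hom_ext fun i => by refine Fin.cases ?_ (fun i => ?_) i <;> rfl

theorem shift_comp {l m n : FI} (f : l ⟶ m) (g : m ⟶ n) : shift (f ≫ g) = shift f ≫ shift g :=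
  hom_ext fun i => by refine Fin.cases ?_ (fun i => ?_) i <;> rfl

/-- The cases are whether `f` misses the first element or hits it. Images under the first kind die
in the derivative; the second kind lowers the degree of generators. -/
theorem exists_eq_comp_succ_or {m n : FI} (f : m ⟶ ⟨n.card + 1⟩) :
    (∃ g : m ⟶ n, f = g ≫ succ n) ∨
      ∃ (p : FI) (τ : m ⟶ ⟨p.card + 1⟩) (g : p ⟶ n), p.card < m.card ∧ f = τ ≫ shift g := by
  obtain ⟨m⟩ := m
  let F : Fin m ↪ Fin (n.card + 1) := f
  by_cases h : ∀ i, F i ≠ 0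
  · exact Or.inl ⟨(⟨fun i => (F i).pred (h i), fun a b hab => F.injective (Fin.pred_inj.1 hab)⟩ :
      Fin m ↪ Fin n.card), hom_ext fun i => (Fin.succ_pred _ (h i)).symm⟩
  · push Not at h
    obtain ⟨a, ha⟩ := h
    obtain _ | p := m
    · exact a.elim0
    -- After precomposition with this swap, `F` fixes the first element and is therefore a shift.
    -- The swap is its own inverse.
    let τ : Equiv.Perm (Fin (p + 1)) := Equiv.swap 0 a
    have hτ : ∀ i : Fin p, F (τ i.succ) ≠ 0 := fun i h => by
      have := τ.injective ((F.injective (h.trans ha.symm)).trans (Equiv.swap_apply_left 0 a).symm)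
      exact Fin.succ_ne_zero _ this
    refine Or.inr ⟨⟨p⟩, τ.toEmbedding, (⟨fun i => (F (τ i.succ)).pred (hτ i), fun b c hbc =>
      Fin.succ_injective _ (τ.injective (F.injective (Fin.pred_inj.1 hbc)))⟩ : Fin p ↪ Fin n.card),
      Nat.lt_succ_self p, hom_ext fun i => ?_⟩
    have key : ∀ j : Fin (p + 1), F (τ j) = (show Fin (p + 1) ↪ Fin (n.card + 1) from
        shift (m := ⟨p⟩) (n := n) (⟨fun i => (F (τ i.succ)).pred (hτ i), fun b c hbc =>
      Fin.succ_injective _ (τ.injective (F.injective (Fin.pred_inj.1 hbc)))⟩ :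
        Fin p ↪ Fin n.card)) j := by
      intro j
      refine Fin.cases ?_ (fun j => ?_) j
      · rw [show τ 0 = a from Equiv.swap_apply_left 0 a, ha]
        rfl
      · exact (Fin.succ_pred _ (hτ j)).symm
    have := key (τ i)
    rwa [show τ (τ i) = i from Equiv.swap_apply_self 0 a i] at this

/-- A point outside the image of `f` serves as the value at the new first element. Hence whatever
`succ m` kills is killed by every map to a larger set. -/
theorem exists_eq_succ_comp {m n : FI} (f : m ⟶ n) (h : m.card < n.card) :
    ∃ g : (⟨m.card + 1⟩ : FI) ⟶ n, f = succ m ≫ g := by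
  let F : Fin m.card ↪ Fin n.card := f
  obtain ⟨x, hx⟩ : ∃ x, ∀ i, F i ≠ x := by
    by_contra! hF
    have := Fintype.card_le_of_surjective F hF
    simp only [Fintype.card_fin] at this
    omega
  refine ⟨(⟨Fin.cons x F, Fin.cons_injective_iff.2 ⟨?_, F.injective⟩⟩ :
    Fin (m.card + 1) ↪ Fin n.card), hom_ext fun i => rfl⟩
  rintro ⟨i, hi⟩
  exact hx i hi

end FI

namespace FIModule

variable {R : Type w} [CommRing R]

/-- The derivative of an `FI`-module: the cokernel of `V_n ⟶ V_{n + 1}`. -/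
noncomputable def derivative (V : FI ⥤ ModuleCat.{u} R) : FI ⥤ ModuleCat.{u} R where
  obj n := ModuleCat.of R (V.obj ⟨n.card + 1⟩ ⧸ LinearMap.range (V.map (FI.succ n)).hom)
  map {m n} f := ModuleCat.ofHom (Submodule.mapQ _ _ (V.map (FI.shift f)).hom (by
    rintro _ ⟨x, rfl⟩
    refine ⟨(V.map f).hom x, ?_⟩
    have := congrArg (fun g => (V.map g).hom x) (FI.succ_comp_shift f)
    simpa using this.symm))
  map_id n := by
    refine ModuleCat.hom_ext (Submodule.linearMap_qext _ (LinearMap.ext fun x => ?_))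
    simp [FI.shift_id]
  map_comp f g := by
    refine ModuleCat.hom_ext (Submodule.linearMap_qext _ (LinearMap.ext fun x => ?_))
    simp [FI.shift_comp]

/-- The projection to the derivative. -/
noncomputable def toDerivative (V : FI ⥤ ModuleCat.{u} R) (n : FI) :
    V.obj ⟨n.card + 1⟩ →ₗ[R] (derivative V).obj n :=
  Submodule.mkQ (LinearMap.range (V.map (FI.succ n)).hom)

theorem range_toDerivative (V : FI ⥤ ModuleCat.{u} R) (n : FI) :
    LinearMap.range (toDerivative V n) = ⊤ :=
  Submodule.range_mkQ _

variable {V : FI ⥤ ModuleCat.{u} R}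

theorem toDerivative_map_succ {n : FI} (x : V.obj n) :
    toDerivative V n ((V.map (FI.succ n)).hom x) = 0 :=
  (Submodule.Quotient.mk_eq_zero _).2 ⟨x, rfl⟩

theorem derivative_map_toDerivative {m n : FI} (f : m ⟶ n) (x : V.obj ⟨m.card + 1⟩) :
    ((derivative V).map f).hom (toDerivative V m x) =
      toDerivative V n ((V.map (FI.shift f)).hom x) := rfl

/-- The derivative lowers the degree of generation. -/
theorem exists_generators_derivative {d : ℕ} {S : Set (Σ m : FI, V.obj m)} (hS : S.Finite)
    (hd : ∀ s ∈ S, s.1.card < d + 1) (hspan : ∀ n, spanImages S n = ⊤) :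
    ∃ S' : Set (Σ m : FI, (derivative V).obj m), S'.Finite ∧ (∀ s ∈ S', s.1.card < d) ∧
      ∀ n, spanImages S' n = ⊤ := by
  refine ⟨⋃ s ∈ S, ⋃ p ∈ Set.Iio d, Set.range fun τ : Fin s.1.card ↪ Fin (p + 1) =>
    (⟨⟨p⟩, toDerivative V ⟨p⟩ ((V.map (show s.1 ⟶ ⟨p + 1⟩ from τ)).hom s.2)⟩ :
      Σ m : FI, (derivative V).obj m), ?_, ?_, fun n => ?_⟩
  · exact hS.biUnion fun s _ => (Set.finite_Iio d).biUnion fun p _ => Set.finite_range _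
  · intro s' hs'
    simp only [Set.mem_iUnion] at hs'
    obtain ⟨s, hs, p, hp, τ, rfl⟩ := hs'
    exact hp
  · rw [eq_top_iff, ← range_toDerivative, LinearMap.range_eq_map, ← hspan ⟨n.card + 1⟩,
      spanImages, Submodule.map_span]
    refine Submodule.span_le.2 ?_
    rintro _ ⟨_, ⟨s, hs, f, rfl⟩, rfl⟩
    rcases FI.exists_eq_comp_succ_or f with ⟨g, rfl⟩ | ⟨p, τ, g, hp, rfl⟩
    · rw [V.map_comp, ModuleCat.hom_comp, LinearMap.comp_apply, toDerivative_map_succ]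
      exact zero_mem _
    · refine Submodule.subset_span ⟨⟨p, toDerivative V p ((V.map τ).hom s.2)⟩, ?_, g, ?_⟩
      · simp only [Set.mem_iUnion]
        exact ⟨s, hs, p.card, by have := hd s hs; simp only [Set.mem_Iio]; omega, τ, rfl⟩
      · rw [derivative_map_toDerivative, V.map_comp, ModuleCat.hom_comp, LinearMap.comp_apply]

/-- The torsion of a finitely generated `FI`-module over a Noetherian ring vanishes eventually. -/
theorem eventually_injective_succ [IsNoetherianRing R] (hV : FG V) :
    ∃ N, ∀ n : FI, N ≤ n.card → Function.Injective (V.map (FI.succ n)).hom := by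
  -- The kernels form a submodule, because `succ` is natural with respect to `shift`, and so have
  -- generators of bounded degree. Beyond that degree all images of these generators vanish.
  obtain ⟨S, hS, hSA, hle⟩ := exists_finite_le_spanImages hV
    (fun n => LinearMap.ker (V.map (FI.succ n)).hom) (by
      intro n n' g x hx
      rw [LinearMap.mem_ker] at hx ⊢
      have := congrArg (fun g => (V.map g).hom x) (FI.succ_comp_shift g)
      simp only [Functor.map_comp, ModuleCat.hom_comp, LinearMap.comp_apply] at this
      rw [← this, hx, map_zero])
  obtain ⟨d, hd⟩ := (hS.image fun s => s.1.card).bddAbove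
  refine ⟨d + 1, fun n hn => LinearMap.ker_eq_bot.1 (eq_bot_iff.2 ((hle n).trans ?_))⟩
  refine Submodule.span_le.2 ?_
  rintro _ ⟨s, hs, f, rfl⟩
  have hsd : s.1.card ≤ d := hd ⟨s, hs, rfl⟩
  obtain ⟨g, rfl⟩ := FI.exists_eq_succ_comp f (by omega)
  have h0 : (V.map (FI.succ s.1)).hom s.2 = 0 := hSA s hs
  simp [h0]

theorem module_finite {S : Set (Σ m : FI, V.obj m)} (hS : S.Finite)
    (hspan : ∀ n, spanImages S n = ⊤) (n : FI) : Module.Finite R (V.obj n) := by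
  refine ⟨Submodule.fg_def.2 ⟨_, ?_, hspan n⟩⟩
  have : {y | ∃ s ∈ S, ∃ f : s.1 ⟶ n, (V.map f).hom s.2 = y} =
      ⋃ s ∈ S, Set.range fun f : Fin s.1.card ↪ Fin n.card =>
        (V.map (show s.1 ⟶ n from f)).hom s.2 := by
    ext y
    simp only [Set.mem_ofPred_eq, Set.mem_iUnion, Set.mem_range, exists_prop]
    rfl
  rw [this]
  exact hS.biUnion fun s _ => Set.finite_range _

/-! ### Eventual polynomiality of dimensions -/

/-- A sequence with polynomial differences is a polynomial. -/
theorem exists_sum_choose_of_difference {F : ℕ → ℚ} {d : ℕ} {c : ℕ → ℚ}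
    (h : ∀ᶠ n in Filter.atTop, F (n + 1) = F n + ∑ k ∈ Finset.range d, c k * n.choose k) :
    ∃ c' : ℕ → ℚ, ∀ᶠ n in Filter.atTop,
      F n = ∑ k ∈ Finset.range (d + 1), c' k * n.choose k := by
  obtain ⟨N, hN⟩ := Filter.eventually_atTop.1 h
  -- By Pascal's rule `n.choose (k + 1)` has difference `n.choose k`, so the coefficients shift by
  -- one; the constant term is fitted at `N`.
  refine ⟨fun k => k.casesOn (F N - ∑ k ∈ Finset.range d, c k * N.choose (k + 1)) c,
    Filter.eventually_atTop.2 ⟨N, fun n hn => ?_⟩⟩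
  rw [Finset.sum_range_succ']
  induction n, hn using Nat.le_induction with
  | base => simp
  | succ n hn ih =>
    rw [hN n hn, ih]
    simp only [Nat.choose_succ_succ, Nat.cast_add, mul_add, Finset.sum_add_distrib,
      Nat.choose_zero_right]
    ring

/-- Once `V_n → V_{n+1}` is injective, the difference of dimensions is the dimension of the
derivative. The degree bound is strict so that the induction starts at the zero module. -/
theorem exists_sum_choose_finrank {K : Type w} [Field K] (d : ℕ) :
    ∀ (V : FI ⥤ ModuleCat.{u} K) (S : Set (Σ m : FI, V.obj m)), S.Finite →
      (∀ s ∈ S, s.1.card < d) → (∀ n, spanImages S n = ⊤) →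
      ∃ c : ℕ → ℚ, ∀ᶠ n : ℕ in Filter.atTop,
        (Module.finrank K (V.obj ⟨n⟩) : ℚ) = ∑ k ∈ Finset.range d, c k * n.choose k := by
  induction d with
  | zero =>
    intro V S _ hd hspan
    refine ⟨0, Filter.Eventually.of_forall fun n => ?_⟩
    have hbot : (⊤ : Submodule K (V.obj ⟨n⟩)) = ⊥ := by
      rw [← hspan, eq_bot_iff]
      refine Submodule.span_le.2 ?_
      rintro _ ⟨s, hs, -⟩
      exact absurd (hd s hs) (Nat.not_lt_zero _)
    rw [← finrank_top, hbot]
    simp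
  | succ d ih =>
    intro V S hS hd hspan
    obtain ⟨S', hS', hd', hspan'⟩ := exists_generators_derivative hS hd hspan
    obtain ⟨c, hc⟩ := ih _ S' hS' hd' hspan'
    obtain ⟨N, hN⟩ := eventually_injective_succ (V := V)
      ⟨d, S, hS, fun s hs => Nat.lt_succ_iff.1 (hd s hs), hspan⟩
    refine exists_sum_choose_of_difference (c := c) ?_
    filter_upwards [hc, Filter.eventually_ge_atTop N] with n hn hNn
    have hfin := module_finite hS hspan ⟨n + 1⟩
    have h1 := Submodule.finrank_quotient_add_finrank
      (LinearMap.range (V.map (FI.succ ⟨n⟩)).hom)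
    have h2 := LinearMap.finrank_range_of_inj (hN ⟨n⟩ hNn)
    have h3 : Module.finrank K (V.obj ⟨n + 1⟩) = Module.finrank K (V.obj ⟨n⟩) +
        Module.finrank K ((derivative V).obj ⟨n⟩) := by
      rw [h2, add_comm] at h1
      exact h1.symm
    rw [h3, Nat.cast_add, hn]

open Polynomial in
/-- The dimensions of a finitely generated `FI`-module are eventually polynomial. -/
theorem FGInDegree.exists_polynomial {K : Type w} [Field K] {V : FI ⥤ ModuleCat.{u} K} {d : ℕ}
    (hV : FGInDegree V d) : ∃ p : ℚ[X], p.natDegree ≤ d ∧ ∀ᶠ n : ℕ in Filter.atTop,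
      (Module.finrank K (V.obj ⟨n⟩) : ℚ) = p.eval (n : ℚ) := by
  obtain ⟨S, hS, hd, hspan⟩ := hV
  obtain ⟨c, hc⟩ := exists_sum_choose_finrank (d + 1) V S hS
    (fun s hs => Nat.lt_succ_iff.2 (hd s hs)) hspan
  refine ⟨∑ k ∈ Finset.range (d + 1), C (c k / k.factorial) * descPochhammer ℚ k, ?_, ?_⟩
  · refine natDegree_sum_le_of_forall_le _ _ fun k hk => (natDegree_C_mul_le _ _).trans ?_
    rw [descPochhammer_natDegree]
    exact Nat.lt_succ_iff.1 (Finset.mem_range.1 hk)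
  · filter_upwards [hc] with n hn
    rw [hn, eval_finsetSum]
    refine Finset.sum_congr rfl fun k _ => ?_
    rw [eval_mul, eval_C, Nat.cast_choose_eq_descPochhammer_div]
    ring

open Polynomial in
-- Otherwise `q = o(p)`, so `|p| ≤ |q| ≤ |p| / 2` at large integers, forcing roots of `p` where it
-- has none.
theorem natDegree_le_of_eventually_le {p q : ℚ[X]} {d : ℕ} (hq : q.natDegree ≤ d)
    (h : ∀ᶠ n : ℕ in Filter.atTop, |p.eval (n : ℚ)| ≤ |q.eval (n : ℚ)|) : p.natDegree ≤ d := by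
  by_contra! hlt
  have hp : p ≠ 0 := by rintro rfl; simp at hlt
  have hdeg : q.degree < p.degree := degree_lt_degree (hq.trans_lt hlt)
  have h1 := (isLittleO_atTop_of_degree_lt q p hdeg).def (c := 1 / 2) (by norm_num)
  have h2 := eventually_atTop_not_isRoot p hp
  have hcast : Filter.Tendsto (fun n : ℕ => (n : ℚ)) Filter.atTop Filter.atTop :=
    tendsto_natCast_atTop_atTop
  obtain ⟨n, hn, hn1, hn2⟩ := (h.and ((hcast.eventually h1).and (hcast.eventually h2))).exists
  refine hn2 ?_
  have hn1' : ((|q.eval (n : ℚ)| : ℚ) : ℝ) ≤ 1 / 2 * ((|p.eval (n : ℚ)| : ℚ) : ℝ) := by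
    rw [← Rat.norm_cast_real, ← Rat.norm_cast_real, Real.norm_eq_abs, Real.norm_eq_abs] at hn1
    exact_mod_cast hn1
  have h3 : |q.eval (n : ℚ)| ≤ 1 / 2 * |p.eval (n : ℚ)| := by
    have : ((|q.eval (n : ℚ)| : ℚ) : ℝ) ≤ ((1 / 2 * |p.eval (n : ℚ)| : ℚ) : ℝ) := by
      push_cast at hn1' ⊢
      exact hn1'
    exact_mod_cast this
  have h4 : |p.eval (n : ℚ)| ≤ 0 := by linarith
  exact abs_nonpos_iff.1 h4

/-- The dimensions of a `d`-small `FI`-module are eventually polynomial of degree at most `d`. -/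
theorem IsSmall.exists_polynomial {K : Type w} [Field K] {V : FI ⥤ ModuleCat.{u} K} {d : ℕ}
    (hV : IsSmall d V) : ∃ p : Polynomial ℚ, p.natDegree ≤ d ∧ ∀ᶠ n : ℕ in Filter.atTop,
      (Module.finrank K (V.obj ⟨n⟩) : ℚ) = p.eval (n : ℚ) := by
  obtain ⟨⟨e, he⟩, U, hU, A, ι, π, hι, hπ⟩ := hV
  -- The polynomial comes from `V`, whose generation degree is uncontrolled; the degree bound comes
  -- from the ambient module `U`.
  obtain ⟨p, -, hp⟩ := he.exists_polynomial
  obtain ⟨q, hq, hq'⟩ := hU.exists_polynomial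
  refine ⟨p, natDegree_le_of_eventually_le hq ?_, hp⟩
  obtain ⟨S, hS, -, hspan⟩ := hU
  filter_upwards [hp, hq'] with n hn hn'
  rw [← hn, ← hn', Nat.abs_cast, Nat.abs_cast, Nat.cast_le]
  have := module_finite hS hspan ⟨n⟩
  have := Module.Finite.of_injective _ (hι ⟨n⟩)
  exact (LinearMap.finrank_le_finrank_of_surjective (hπ ⟨n⟩)).trans
    (LinearMap.finrank_le_finrank_of_injective (hι ⟨n⟩))

end FIModule

/-! ### The tuples of vertices of an `FI`-graph -/

/-- The map of vertices induced by an injection. -/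
def FI.vertexMap (G : FI ⥤ FinGraph.{u}) {m n : FI} (f : m ⟶ n) : (G.obj m).V → (G.obj n).V :=
  FinGraph.vmap (G.map f)

theorem FI.vertexMap_id (G : FI ⥤ FinGraph.{u}) (n : FI) (a : (G.obj n).V) :
    FI.vertexMap G (𝟙 n) a = a := by
  rw [FI.vertexMap, G.map_id]; rfl

theorem FI.vertexMap_comp (G : FI ⥤ FinGraph.{u}) {l m n : FI} (f : l ⟶ m) (g : m ⟶ n)
    (a : (G.obj l).V) :
    FI.vertexMap G (f ≫ g) a = FI.vertexMap G g (FI.vertexMap G f a) := by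
  rw [FI.vertexMap, G.map_comp]; rfl

/-- Stability is iterated downwards until the degree is at most `d`. -/
theorem VertexStable.exists_eq_vertexMap {G : FI ⥤ FinGraph.{u}} {d : ℕ} (hG : VertexStable G d)
    (n : ℕ) (a : (G.obj ⟨n⟩).V) :
    ∃ (m : FI) (f : m ⟶ ⟨n⟩) (b : (G.obj m).V), m.card ≤ d ∧ FI.vertexMap G f b = a := by
  induction n with
  | zero => exact ⟨_, 𝟙 _, a, Nat.zero_le _, FI.vertexMap_id G _ a⟩
  | succ n ih =>
    rcases Nat.lt_or_ge n d with h | h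
    · exact ⟨_, 𝟙 _, a, h, FI.vertexMap_id G _ a⟩
    · obtain ⟨b, f, rfl⟩ := hG n h a
      obtain ⟨m, g, c, hm, rfl⟩ := ih b
      exact ⟨m, g ≫ f, c, hm, FI.vertexMap_comp G g f c⟩

/-- Finitely many vertices come from a common subset of bounded size. -/
theorem VertexStable.exists_eq_vertexMap_pi {G : FI ⥤ FinGraph.{u}} {d : ℕ}
    (hG : VertexStable G d) {N : ℕ} (n : FI) (a : Fin N → (G.obj n).V) :
    ∃ (m : FI) (f : m ⟶ n) (b : Fin N → (G.obj m).V), m.card ≤ N * d ∧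
      ∀ j, FI.vertexMap G f (b j) = a j := by
  classical
  choose m f b hm hb using fun j => hG.exists_eq_vertexMap n.card (a j)
  let F : ∀ j, Fin (m j).card ↪ Fin n.card := f
  -- The common subset is the union of the images of the `N` injections, each of size at most `d`.
  let U : Finset (Fin n.card) := Finset.univ.biUnion fun j => Finset.univ.map (F j)
  have hU : U.card ≤ N * d := by
    refine (Finset.card_biUnion_le_card_mul _ _ d fun j _ => ?_).trans (by simp)
    simpa using hm j
  have hmem : ∀ j i, F j i ∈ U := fun j i =>
    Finset.mem_biUnion.2 ⟨j, Finset.mem_univ _, Finset.mem_map_of_mem _ (Finset.mem_univ i)⟩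
  let e := U.equivFin
  let g : (⟨U.card⟩ : FI) ⟶ n := (e.symm.toEmbedding.trans (Function.Embedding.subtype _) :
    Fin U.card ↪ Fin n.card)
  let h : ∀ j, m j ⟶ (⟨U.card⟩ : FI) := fun j =>
    (⟨fun i => e ⟨F j i, hmem j i⟩, fun x y hxy =>
      (F j).injective (congrArg Subtype.val (e.injective hxy))⟩ : Fin (m j).card ↪ Fin U.card)
  have hgh : ∀ j, h j ≫ g = f j := fun j => FI.hom_ext fun i => by
    change ((e.symm (e ⟨F j i, hmem j i⟩) : U) : Fin n.card) = F j i
    simp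
  refine ⟨⟨U.card⟩, g, fun j => FI.vertexMap G (h j) (b j), hU, fun j => ?_⟩
  rw [← FI.vertexMap_comp, hgh, hb]

/-! ### The FI-module of functions on tuples -/

section Tuples

variable {W : Type v} [Fintype W] {R : Type w} [CommRing R]

open Classical in
/-- The push-forward of functions on tuples along a graph homomorphism. -/
noncomputable def tuplePush {G H : FinGraph.{u}} (f : G ⟶ H) (N : ℕ) :
    ((Fin N → W × G.V) → R) →ₗ[R] ((Fin N → W × H.V) → R) where
  toFun c t := ∑ s : Fin N → W × G.V, if Prod.map id (FinGraph.vmap f) ∘ s = t then c s else 0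
  map_add' a b := by
    ext t
    simp only [Pi.add_apply, ← Finset.sum_add_distrib]
    refine Finset.sum_congr rfl fun s _ => ?_
    split_ifs <;> simp
  map_smul' r a := by
    ext t
    simp [Finset.mul_sum]

theorem tuplePush_single [DecidableEq W] {G H : FinGraph.{u}} [DecidableEq G.V] [DecidableEq H.V]
    (f : G ⟶ H) {N : ℕ} (s : Fin N → W × G.V) (r : R) :
    tuplePush f N (Pi.single s r) = Pi.single (Prod.map id (FinGraph.vmap f) ∘ s) r := by
  ext t
  simp only [tuplePush, LinearMap.coe_mk, AddHom.coe_mk]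
  rw [Finset.sum_eq_single s]
  · simp [Pi.single_apply, eq_comm]
  · intro s' _ hs'
    simp [hs']
  · simp

theorem tuplePush_id (G : FinGraph.{u}) (N : ℕ) :
    tuplePush (W := W) (R := R) (𝟙 G) N = LinearMap.id := by
  classical
  refine LinearMap.pi_ext fun s r => ?_
  rw [tuplePush_single]
  rfl

theorem tuplePush_comp {G H K : FinGraph.{u}} (f : G ⟶ H) (g : H ⟶ K) (N : ℕ) :
    tuplePush (W := W) (R := R) (f ≫ g) N = (tuplePush g N).comp (tuplePush f N) := by
  classical
  refine LinearMap.pi_ext fun s r => ?_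
  rw [LinearMap.comp_apply, tuplePush_single, tuplePush_single, tuplePush_single]
  rfl

variable (W R) in
/-- The `FI`-module of functions on the `N`-tuples of pairs of an element of `W` and a vertex. -/
noncomputable def tupleModule (G : FI ⥤ FinGraph.{u}) (N : ℕ) :
    FI ⥤ ModuleCat.{max u v w} R where
  obj n := ModuleCat.of R ((Fin N → W × (G.obj n).V) → R)
  map f := ModuleCat.ofHom (tuplePush (G.map f) N)
  map_id n := by rw [G.map_id, tuplePush_id]; rfl
  map_comp f g := by rw [G.map_comp, tuplePush_comp]; rfl

/-- Every basis tuple is the image of a basis tuple in degree at most `N * d`. The bound `he` is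
asked only when some labelling `Fin N → W` exists: if `W` is empty and `N > 0`, the module is zero
and generated in every degree. -/
theorem fgInDegree_tupleModule {G : FI ⥤ FinGraph.{u}} {d : ℕ} (hG : VertexStable G d) {N e : ℕ}
    (he : (Fin N → W) → N * d ≤ e) : FIModule.FGInDegree (tupleModule W R G N) e := by
  classical
  refine ⟨⋃ p ∈ Set.Iic e, Set.range fun s : Fin N → W × (G.obj ⟨p⟩).V =>
    (⟨⟨p⟩, (Pi.single s 1 : (Fin N → W × (G.obj ⟨p⟩).V) → R)⟩ :
      Σ m : FI, (tupleModule W R G N).obj m), ?_, ?_, fun n => ?_⟩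
  · exact (Set.finite_Iic e).biUnion fun p _ => Set.finite_range _
  · intro s hs
    simp only [Set.mem_iUnion] at hs
    obtain ⟨p, hp, s, rfl⟩ := hs
    exact hp
  · refine eq_top_iff.2 ((Pi.basisFun R (Fin N → W × (G.obj n).V)).span_eq.symm.le.trans ?_)
    refine Submodule.span_mono ?_
    rintro _ ⟨t, rfl⟩
    obtain ⟨m, f, b, hm, hb⟩ := hG.exists_eq_vertexMap_pi n fun j => (t j).2
    refine ⟨⟨m, (Pi.single (fun j => ((t j).1, b j)) 1 : (Fin N → W × (G.obj m).V) → R)⟩, ?_, f, ?_⟩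
    · simp only [Set.mem_iUnion]
      exact ⟨m.card, hm.trans (he fun j => (t j).1), _, rfl⟩
    · refine (tuplePush_single (G.map f) _ 1).trans ?_
      rw [Pi.basisFun_apply]
      congr 1
      funext j
      exact Prod.ext rfl (hb j)

end Tuples

/-! ### The homology of the Hom-complex -/

section Homology

variable {W : Type v} [Fintype W] (T : SimpleGraph W) (G : FI ⥤ FinGraph.{u})
  (R : Type w) [CommRing R]

/-- The inclusion of the chains of the Hom-complex in the functions on tuples. -/
noncomputable def chainsToTuples (i : ℕ) :
    homComplexChains T G R ⋙ HomologicalComplex.eval _ _ i ⟶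
      tupleModule W R G (Fintype.card W + i) where
  app n := ModuleCat.ofHom (HomComplex.chains T R (G.obj n) i).subtype
  naturality _ _ _ := rfl

/-- The intermediate module is that of the cycles, which inject into the chains and surject onto
homology. -/
theorem isSubquotient_homology (i : ℕ) :
    FIModule.IsSubquotient (FIModule.homology (homComplexChains T G R) i)
      (tupleModule W R G (Fintype.card W + i)) := by
  let ι : homComplexChains T G R ⋙ HomologicalComplex.cyclesFunctor _ _ i ⟶
      homComplexChains T G R ⋙ HomologicalComplex.eval _ _ i :=
    { app n := ((homComplexChains T G R).obj n).iCycles i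
      naturality m n f := HomologicalComplex.cyclesMap_i _ _ }
  refine ⟨homComplexChains T G R ⋙ HomologicalComplex.cyclesFunctor _ _ i,
    ι ≫ chainsToTuples T G R i,
    Functor.whiskerLeft _ (HomologicalComplex.natTransHomologyπ _ _ i), fun n => ?_, fun n => ?_⟩
  · have h1 : Function.Injective (ι.app n).hom :=
      (ModuleCat.mono_iff_injective (((homComplexChains T G R).obj n).iCycles i)).1 inferInstance
    exact (HomComplex.chains T R (G.obj n) i).injective_subtype.comp h1
  · exact (ModuleCat.epi_iff_surjective
      (((homComplexChains T G R).obj n).homologyπ i)).1 inferInstance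

variable {G}

theorem isSmall_homology [IsNoetherianRing R] {d : ℕ} (hG : VertexStable G d) (i : ℕ) :
    FIModule.IsSmall ((i + 1) * d * Fintype.card W)
      (FIModule.homology (homComplexChains T G R) i) := by
  have h : FIModule.FGInDegree (tupleModule W R G (Fintype.card W + i))
      ((i + 1) * d * Fintype.card W) := by
    refine fgInDegree_tupleModule hG fun t => ?_
    -- This fails for empty `W` and `i > 0`; the labelling `t` excludes that case.
    have hle : Fintype.card W + i ≤ (i + 1) * Fintype.card W := by
      rcases Nat.eq_zero_or_pos (Fintype.card W + i) with h0 | hpos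
      · omega
      · have : 0 < Fintype.card W := Fintype.card_pos_iff.2 ⟨t ⟨0, hpos⟩⟩
        nlinarith
    calc (Fintype.card W + i) * d ≤ (i + 1) * Fintype.card W * d := Nat.mul_le_mul_right d hle
      _ = (i + 1) * d * Fintype.card W := by ring
  exact ⟨(isSubquotient_homology T G R i).fg ⟨_, h⟩, _, h, isSubquotient_homology T G R i⟩

end Homology

theorem mainTheorem5 {W : Type v} [Fintype W] (T : SimpleGraph W)
    (G : FI ⥤ FinGraph.{u}) (d : ℕ) (hG : VertexStable G d) :
    (∀ i : ℕ, FIModule.IsSmall ((i + 1) * d * Fintype.card W)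
      (FIModule.homology (homComplexChains T G ℤ) i)) ∧
    HomComplexRepresentationStable T G ∧
    (∀ i : ℕ, ∃ p : Polynomial ℚ, p.natDegree ≤ (i + 1) * d * Fintype.card W ∧
      ∀ᶠ n : ℕ in Filter.atTop,
        (Module.finrank ℝ ((FIModule.homology (homComplexChains T G ℝ) i).obj ⟨n⟩) : ℚ)
          = p.eval (n : ℚ)) :=
  -- Smallness is proved over every Noetherian ring, so the real case needs no change of
  -- coefficients from `ℤ`.
  ⟨isSmall_homology T ℤ hG, fun i => (isSmall_homology T ℤ hG i).1,
    fun i => (isSmall_homology T ℝ hG i).exists_polynomial⟩
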